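/- Let $I=[-1,1]$ and $d=2$. Let $\mathcal F$ be the set of bijective maps $f:I^2\to I^2$ that are bi-Lipschitz, i.e. for which there is $L>0$ with $L^{-1}\|x-x'\|_2\le\|f(x)-f(x')\|_2\le L\|x-x'\|_2$ for all $x,x'\in I^2$. Let $\sigma>0$ and let $P_X$ be a probability measure on $I^2$ that is absolutely continuous with respect to Lebesgue measure and has support $I^2$. For $f_*\in\mathcal F$ and $n\ge 1$ let $\mathbb P_{f_*}$ be the law of the sample $\mathcal D_n=\{(X_i,Y_i)\}_{i=1}^n$, where $Y_i=f_*(X_i)+\varepsilon_i$, the $X_i$ are i.i.d. with law $P_X$, the $\varepsilon_i$ are i.i.d. with law $N_2(0,\sigma^2 I_2)$, and the $X_i$ and $\varepsilon_i$ are independent. An estimator $\bar f_n$ assigns to the sample a map $I^2\to\mathbb R^2$, jointly measurably in the sample and the argument $x\in I^2$. Fix $c\in\mathbb R^2\setminus I^2$. For a map $g:I^2\to\mathbb R^2$ and $y\in I^2$ let $g^{-1}(y)$ be the unique $x\in I^2$ with $g(x)=y$ if exactly one such $x$ exists, and $c$ otherwise. With $\|h\|_{L^2(P_X)}=\big(\sum_{j=1}^2\int_{I^2}|h_j|^2\,dP_X\big)^{1/2}\in[0,\infty]$,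 the inverse risk of $\bar f_n$ is $$R_{\mathrm{INV}}(\bar f_n,f_*)=\|\bar f_n-f_*\|_{L^2(P_X)}^2+\|\bar f_n^{-1}-f_*^{-1}\|_{L^2(P_X)}^4 .$$ Then there is a constant $C_*>0$, depending only on $\sigma$ and $P_X$, such that for every $c\in\mathbb R^2\setminus I^2$ and every $n\ge1$ $$\inf_{\bar f_n}\ \sup_{f_*\in\mathcal F}\ \mathbb P_{f_*}\Big(R_{\mathrm{INV}}(\bar f_n,f_*)\ \ge\ C_*\,n^{-2/(2+d)}\Big)\ >\ \frac12 ,$$ where the infimum is over all estimators based on $n$ observations. -/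

import Mathlib

open MeasureTheory ProbabilityTheory
open scoped ENNReal

noncomputable section

namespace InvReg

/-- The Euclidean plane `ℝ²`. -/
abbrev Plane : Type := EuclideanSpace ℝ (Fin 2)

/-- The closed square `I² = [-1, 1]²`, as a subset of the plane. -/
def square : Set Plane := {x | ∀ j, x j ∈ Set.Icc (-1 : ℝ) 1}

/-- The square as a type, with the Euclidean distance and the Borel `σ`-algebra inherited from
the plane. -/
abbrev Square : Type := square

/-- Lebesgue measure on the square. -/
def lebesgueSquare : Measure Square := (volume : Measure Plane).comap Subtype.val

/-- The class of invertible bi-Lipschitz maps `f : I² → I²`; the constant `L` may depend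
on `f`. -/
def biLipInv : Set (Square → Square) :=
  {f | (∀ y, ∃! x, f x = y) ∧
    ∃ L : ℝ, 0 < L ∧ ∀ x x' : Square,
      L⁻¹ * dist x x' ≤ dist (f x) (f x') ∧ dist (f x) (f x') ≤ L * dist x x'}

/-- Regard an `I²`-valued map as a plane-valued one. -/
def toPlane (f : Square → Square) : Square → Plane := fun x => (f x : Plane)

open Classical in
/-- The generalized inverse of a map `g` on `I²`: at `y ∈ I²` it is the unique `x ∈ I²` with
`g x = y` if there is exactly one such `x`, and the constant `c` otherwise. -/
def genInv (c : Plane) (g : Square → Plane) (y : Square) : Plane :=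
  if h : ∃! x : Square, g x = (y : Plane) then (h.choose : Plane) else c

/-- The `L²(P)` norm `(∑ⱼ ∫ |fⱼ|² dP)^{1/2}` of a plane-valued function, with values in
`[0, ∞]`. -/
def l2norm (P : Measure Square) (f : Square → Plane) : ℝ≥0∞ :=
  (∑ j : Fin 2, ∫⁻ x, ‖f x j‖ₑ ^ 2 ∂P) ^ (1 / 2 : ℝ)

/-- The inverse risk `‖g - f‖² + ψ(‖g⁻¹ - f⁻¹‖)` with `ψ(z) = z⁴`, both norms being those of
`L²(P)`. -/
def inverseRisk (P : Measure Square) (c : Plane) (g f : Square → Plane) : ℝ≥0∞ :=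
  l2norm P (fun x => g x - f x) ^ 2
    + l2norm P (fun y => genInv c g y - genInv c f y) ^ 4

/-- The law of one observation `(X, Y)`, where `Y = f(X) + ε` with `X ∼ P` and
`ε ∼ N₂(0, σ² I₂)` independent. -/
def obsLaw (P : Measure Square) (σ : ℝ) (f : Square → Square) : Measure (Square × Plane) :=
  (P.prod (multivariateGaussian (0 : Plane) (σ ^ 2 • (1 : Matrix (Fin 2) (Fin 2) ℝ)))).map
    (fun p => (p.1, toPlane f p.1 + p.2))

/-- The law of a sample of `n` i.i.d. observations from the regression model. -/
def dataLaw (P : Measure Square) (σ : ℝ) (f : Square → Square) (n : ℕ) :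
    Measure (Fin n → Square × Plane) :=
  Measure.pi (fun _ => obsLaw P σ f)

/-- A measurable estimator based on `n` observations: a map sending the data `D` and a point
`x ∈ I²` to the estimated value at `x`, jointly measurable in `(D, x)`. -/
def Estimator (n : ℕ) : Type :=
  {F : (Fin n → Square × Plane) → Square → Plane // Measurable (Function.uncurry F)}

end InvReg

end

/-! The rate plays no role: since the bi-Lipschitz constant may depend on `f`, the risk is bounded
below by a constant `s` independent of `n`, and `n ^ (-1/2) ≤ 1`. The inverse term is nonnegative
and is dropped (`sqDist_le_inverseRisk`), so the bound is uniform in `c`. For each `n`, shear the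
square vertically along a profile made of disjoint bumps so narrow that `n` design points meet only
part of the total bump mass (`exists_bumps`, `sum_bumpMass_touched_le`). Each bump carries one of
three levels. With design points and noise fixed, shifting the levels on all untouched bumps by `a :
ZMod 3` leaves the sample unchanged, but the three resulting maps are pairwise `4 * s` apart in
squared distance. An estimate is within `s` of at most one of them, so at most a third of the family
is estimated well (`three_mul_card_sqDist_lt_le`). Averaging over design, noise and levels gives a
map that is missed with probability at least 2/3 (`exists_dataLaw_sqDist_lt_le`). Two levels would
give only 1/2, and the claim is strict. -/

namespace InvReg

/-! ### Shear maps of the square -/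

/-- The shear-type map `(x₀, x₁) ↦ (x₀, x₁ + θ(x₀) (1 - x₁²) / 4)` of the square. -/
noncomputable def shear (θ : ℝ → ℝ) (hθ : ∀ t, |θ t| ≤ 1) (x : Square) : Square :=
  ⟨!₂[x.1 0, x.1 1 + θ (x.1 0) * ((1 - x.1 1 ^ 2) / 4)], by
    have h0 := x.2 0
    have h1 := x.2 1
    have ht := abs_le.1 (hθ (x.1 0))
    simp only [Set.mem_Icc] at h0 h1
    intro j
    fin_cases j
    · exact h0
    · simp only [Fin.mk_one, Matrix.cons_val_one, Matrix.cons_val_fin_one,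
        Set.mem_Icc]
      constructor <;> nlinarith [mul_nonneg (sub_nonneg.2 h1.1) (sub_nonneg.2 h1.2)]⟩

@[simp] theorem shear_zero (θ : ℝ → ℝ) (hθ : ∀ t, |θ t| ≤ 1) (x : Square) :
    (shear θ hθ x : Plane) 0 = x.1 0 := rfl

@[simp] theorem shear_one (θ : ℝ → ℝ) (hθ : ∀ t, |θ t| ≤ 1) (x : Square) :
    (shear θ hθ x : Plane) 1 = x.1 1 + θ (x.1 0) * ((1 - x.1 1 ^ 2) / 4) := rfl

theorem abs_coord_le_dist (x y : Plane) (j : Fin 2) : |x j - y j| ≤ dist x y := by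
  simpa [dist_eq_norm] using PiLp.norm_apply_le (x - y) j

theorem dist_le_add_abs (x y : Plane) : dist x y ≤ |x 0 - y 0| + |x 1 - y 1| := by
  rw [EuclideanSpace.dist_eq, Fin.sum_univ_two, Real.sqrt_le_left (by positivity)]
  simp only [Real.dist_eq]
  nlinarith [mul_nonneg (abs_nonneg (x 0 - y 0)) (abs_nonneg (x 1 - y 1))]

theorem exists_add_mul_eq (a : ℝ) {y : ℝ} (hy : y ∈ Set.Icc (-1 : ℝ) 1) :
    ∃ t ∈ Set.Icc (-1 : ℝ) 1, t + a * ((1 - t ^ 2) / 4) = y := by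
  have hc : ContinuousOn (fun t : ℝ => t + a * ((1 - t ^ 2) / 4)) (Set.Icc (-1) 1) := by
    fun_prop
  have := intermediate_value_Icc (by norm_num) hc
  obtain ⟨t, ht, hty⟩ := this (by simpa using hy)
  exact ⟨t, ht, hty⟩

/-- Shear maps with a Lipschitz profile are bi-Lipschitz bijections of the square. -/
theorem shear_mem_biLipInv (θ : ℝ → ℝ) (hθ : ∀ t, |θ t| ≤ 1) {K : NNReal}
    (hK : LipschitzWith K θ) : shear θ hθ ∈ biLipInv := by
  have hK0 : (0 : ℝ) ≤ K := K.2
  have key : ∀ x x' : Square,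
      dist x x' ≤ (4 + K) * dist (shear θ hθ x) (shear θ hθ x') ∧
      dist (shear θ hθ x) (shear θ hθ x') ≤ (4 + K) * dist x x' := by
    intro x x'
    rw [Subtype.dist_eq, Subtype.dist_eq]
    have d1 := dist_le_add_abs x.1 x'.1
    have d2 := dist_le_add_abs (shear θ hθ x).1 (shear θ hθ x').1
    have e0 := abs_coord_le_dist x.1 x'.1 0
    have e1 := abs_coord_le_dist x.1 x'.1 1
    have g0 := abs_coord_le_dist (shear θ hθ x).1 (shear θ hθ x').1 0
    have g1 := abs_coord_le_dist (shear θ hθ x).1 (shear θ hθ x').1 1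
    simp only [shear_zero, shear_one] at d2 g0 g1
    have hl : |θ (x.1 0) - θ (x'.1 0)| ≤ K * |x.1 0 - x'.1 0| := by
      simpa [Real.dist_eq] using hK.dist_le_mul (x.1 0) (x'.1 0)
    have b1 := x.2 1
    have b1' := x'.2 1
    simp only [Set.mem_Icc] at b1 b1'
    have hA : |(θ (x.1 0) - θ (x'.1 0)) * ((1 - x'.1 1 ^ 2) / 4)|
        ≤ K * |x.1 0 - x'.1 0| * (1 / 4) := by
      rw [abs_mul]
      apply mul_le_mul hl _ (abs_nonneg _) (by positivity)
      rw [abs_le]; constructor <;> nlinarith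
    -- The factor 1/2, being below 1, lets this term be absorbed into the vertical difference; this
    -- yields the lower Lipschitz bound.
    have hB : |(x.1 1 - x'.1 1) * (θ (x.1 0) * ((x.1 1 + x'.1 1) / 4))|
        ≤ |x.1 1 - x'.1 1| * (1 / 2) := by
      rw [abs_mul]
      apply mul_le_mul_of_nonneg_left _ (abs_nonneg _)
      rw [abs_mul]
      calc |θ (x.1 0)| * |(x.1 1 + x'.1 1) / 4| ≤ 1 * (1 / 2) := by
            apply mul_le_mul (hθ _) _ (abs_nonneg _) zero_le_one
            rw [abs_le]; constructor <;> linarith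
        _ = 1 / 2 := by norm_num
    set p := (θ (x.1 0) - θ (x'.1 0)) * ((1 - x'.1 1 ^ 2) / 4)
    set q := (x.1 1 - x'.1 1) * (θ (x.1 0) * ((x.1 1 + x'.1 1) / 4))
    have hdecomp : x.1 1 + θ (x.1 0) * ((1 - x.1 1 ^ 2) / 4)
        - (x'.1 1 + θ (x'.1 0) * ((1 - x'.1 1 ^ 2) / 4)) = (x.1 1 - x'.1 1) + p - q := by
      simp only [p, q]; ring
    rw [hdecomp] at d2 g1
    set D := dist x.1 x'.1
    set E := dist (shear θ hθ x).1 (shear θ hθ x').1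
    have hp := abs_le.1 hA
    have hq := abs_le.1 hB
    have hDE : 0 ≤ D ∧ 0 ≤ E := ⟨dist_nonneg, dist_nonneg⟩
    have t1 : |x.1 1 - x'.1 1 + p - q| ≤ |x.1 1 - x'.1 1| + |p| + |q| := by
      calc _ ≤ |x.1 1 - x'.1 1 + p| + |q| := abs_sub _ _
        _ ≤ _ := by gcongr; exact abs_add_le _ _
    have t2 : |x.1 1 - x'.1 1| ≤ |x.1 1 - x'.1 1 + p - q| + |p| + |q| := by
      calc |x.1 1 - x'.1 1| = |(x.1 1 - x'.1 1 + p - q) - p + q| := by ring_nf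
        _ ≤ |(x.1 1 - x'.1 1 + p - q) - p| + |q| := abs_add_le _ _
        _ ≤ _ := by gcongr; exact abs_sub _ _
    have m1 := mul_le_mul_of_nonneg_left e0 hK0
    have m2 := mul_le_mul_of_nonneg_left g0 hK0
    constructor <;> nlinarith
  refine ⟨?_, 4 + K, by positivity, fun x x' => ⟨?_, (key x x').2⟩⟩
  · intro y
    obtain ⟨t, ht, hty⟩ := exists_add_mul_eq (θ (y.1 0)) (y.2 1)
    refine ⟨⟨!₂[y.1 0, t], ?_⟩, ?_, ?_⟩
    · intro j
      fin_cases j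
      · exact y.2 0
      · exact ht
    · ext j
      fin_cases j
      · rfl
      · exact hty
    · intro z hz
      have h := (key z ⟨!₂[y.1 0, t], by
        intro j
        fin_cases j
        · exact y.2 0
        · exact ht⟩).1
      have hw : shear θ hθ ⟨!₂[y.1 0, t], by
        intro j
        fin_cases j
        · exact y.2 0
        · exact ht⟩ = y := by
        ext j
        fin_cases j
        · rfl
        · exact hty
      rw [hz, hw, dist_self, mul_zero] at h
      exact dist_le_zero.1 h
  · rw [inv_mul_le_iff₀ (by positivity)]
    exact (key x x').1

/-! ### Absolutely continuous marginals and the displacement weight -/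

theorem measurable_coord (j : Fin 2) : Measurable (fun x : Square => x.1 j) := by
  fun_prop

/-- The coordinate marginals of an absolutely continuous law on the square are absolutely
continuous. -/
theorem map_coord_absolutelyContinuous {P : Measure Square} (hP : P ≪ lebesgueSquare)
    (j : Fin 2) : P.map (fun x : Square => x.1 j) ≪ (volume : Measure ℝ) := by
  refine Measure.AbsolutelyContinuous.mk fun s hs h0 => ?_
  rw [Measure.map_apply (measurable_coord j) hs]
  apply hP
  have hq : Measure.QuasiMeasurePreserving (fun x : Plane => x j) volume volume :=
    (Measure.quasiMeasurePreserving_eval (fun _ : Fin 2 => (volume : Measure ℝ)) j).comp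
      (PiLp.volume_preserving_ofLp (Fin 2)).quasiMeasurePreserving
  have h1 := hq.preimage_null h0
  refine le_antisymm ((Measure.comap_apply_le _ _ ?_).trans ?_) zero_le
  · exact ((measurable_coord j) hs).nullMeasurableSet
  · refine (measure_mono ?_).trans h1.le
    rintro _ ⟨x, hx, rfl⟩
    exact hx

/-- A finite absolutely continuous measure is small on sets of small measure. -/
theorem exists_delta_of_absolutelyContinuous {ν : Measure ℝ} [IsFiniteMeasure ν]
    (hν : ν ≪ volume) {ε : ℝ≥0∞} (hε : ε ≠ 0) :
    ∃ δ > 0, ∀ s, MeasurableSet s → volume s < δ → ν s < ε := by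
  obtain ⟨δ, hδ, h⟩ := exists_pos_setLIntegral_lt_of_measure_lt
    (μ := (volume : Measure ℝ)) (f := ν.rnDeriv volume)
    (Measure.lintegral_rnDeriv_lt_top ν volume).ne hε
  refine ⟨δ, hδ, fun s hs hlt => ?_⟩
  rw [← Measure.withDensity_rnDeriv_eq ν volume hν, withDensity_apply _ hs]
  exact h s hlt

/-- The squared size of the vertical displacement of a shear map with unit profile. -/
noncomputable def wt (x : Square) : ℝ≥0∞ := ‖(1 - x.1 1 ^ 2) / 4‖ₑ ^ 2

theorem measurable_wt : Measurable wt := by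
  unfold wt
  fun_prop

theorem wt_le_one (x : Square) : wt x ≤ 1 := by
  have h1 := x.2 1
  simp only [Set.mem_Icc] at h1
  refine pow_le_one₀ zero_le ?_
  rw [← ofReal_norm, ← ENNReal.ofReal_one]
  apply ENNReal.ofReal_le_ofReal
  rw [Real.norm_eq_abs, abs_le]
  constructor <;> nlinarith

/-- The weight vanishes only on the two horizontal edges, which are null because the second marginal
has no atoms. -/
theorem lintegral_wt_pos {P : Measure Square} [IsProbabilityMeasure P]
    (hP : P ≪ lebesgueSquare) : 0 < ∫⁻ x, wt x ∂P := by
  rw [pos_iff_ne_zero]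
  intro h
  rw [lintegral_eq_zero_iff measurable_wt] at h
  have hnull : P ((fun x : Square => x.1 1) ⁻¹' {1, -1}) = 0 := by
    rw [← Measure.map_apply (measurable_coord 1) (by measurability)]
    apply map_coord_absolutelyContinuous hP
    exact (Set.toFinite _).measure_zero _
  have hall : ∀ᵐ x ∂P, False := by
    filter_upwards [h, measure_eq_zero_iff_ae_notMem.1 hnull] with x hx hx'
    apply hx'
    have h2 : (1 - x.1 1 ^ 2) / 4 = 0 := by simpa [wt] using hx
    have h3 : (x.1 1 - 1) * (x.1 1 + 1) = 0 := by linarith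
    rcases mul_eq_zero.1 h3 with h4 | h4
    · left; linarith
    · right; simp only [Set.mem_singleton_iff]; linarith
  have := hall.exists
  simp at this

/-! ### Narrow bumps of small mass -/

/-- The tent function of height one on `[(k - 1) / m, (k + 1) / m]`. -/
noncomputable def tent (m : ℕ) (k : ℤ) (t : ℝ) : ℝ := max 0 (1 - |m * t - k|)

theorem tent_mem_Icc (m : ℕ) (k : ℤ) (t : ℝ) : tent m k t ∈ Set.Icc (0 : ℝ) 1 :=
  ⟨le_max_left _ _, max_le zero_le_one (by linarith [abs_nonneg (m * t - k)])⟩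

theorem exists_lipschitzWith_tent (m : ℕ) (k : ℤ) :
    ∃ K : NNReal, LipschitzWith K (tent m k) := by
  refine ⟨m, LipschitzWith.of_dist_le_mul fun s t => ?_⟩
  rw [Real.dist_eq, Real.dist_eq, NNReal.coe_natCast]
  calc |tent m k s - tent m k t| ≤ |(1 - |m * s - k|) - (1 - |m * t - k|)| := by
        unfold tent
        rw [max_comm 0, max_comm 0]
        exact abs_max_sub_max_le_abs _ _ _
    _ = |(|m * t - k| - |m * s - k|)| := by ring_nf
    _ ≤ |(m * t - k) - (m * s - k)| := abs_abs_sub_abs_le _ _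
    _ = |(m : ℝ) * (s - t)| := by rw [abs_sub_comm]; ring_nf
    _ = m * |s - t| := by rw [abs_mul, Nat.abs_cast]

theorem abs_lt_of_tent_ne_zero {m : ℕ} {k : ℤ} {t : ℝ} (h : tent m k t ≠ 0) :
    |m * t - k| < 1 := by
  by_contra! hc
  exact h (max_eq_left (by linarith))

/-- Overlapping tents have centres less than two steps apart, so keeping one parity of the index
makes the supports disjoint. -/
theorem eq_of_tent_ne_zero {m : ℕ} {j k : ℤ} {t : ℝ} (hj : tent m j t ≠ 0)
    (hk : tent m k t ≠ 0) (hjk : j % 2 = k % 2) : j = k := by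
  have h1 := abs_lt.1 (abs_lt_of_tent_ne_zero hj)
  have h2 := abs_lt.1 (abs_lt_of_tent_ne_zero hk)
  have h3 : (j : ℝ) - k < (2 : ℤ) := by push_cast; linarith
  have h4 : (k : ℝ) - j < (2 : ℤ) := by push_cast; linarith
  norm_cast at h3 h4
  omega

/-- The two tents around `m * t` take the values `1 - u` and `u`, and `(1 - u) ^ 2 + u ^ 2 ≥ 1 / 2`.
The index `m + 1` is needed at `t = 1`. -/
theorem half_le_sum_tent_sq (m : ℕ) {t : ℝ} (ht : t ∈ Set.Icc (-1 : ℝ) 1) :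
    1 / 2 ≤ ∑ k ∈ Finset.Icc (-(m : ℤ)) (m + 1), tent m k t ^ 2 := by
  have hm : (0 : ℝ) ≤ m := Nat.cast_nonneg m
  have h1 : (m : ℝ) * t ≤ m := by nlinarith [ht.2]
  have h2 : -(m : ℝ) ≤ m * t := by nlinarith [ht.1]
  set k := ⌊(m : ℝ) * t⌋ with hk
  have hk1 : -(m : ℤ) ≤ k := Int.le_floor.2 (by push_cast; exact h2)
  have hk2 : k ≤ m := by
    have : (k : ℝ) ≤ m := (Int.floor_le _).trans h1
    exact_mod_cast this
  have hsub : ({k, k + 1} : Finset ℤ) ⊆ Finset.Icc (-(m : ℤ)) (m + 1) := by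
    intro j hj
    simp only [Finset.mem_insert, Finset.mem_singleton] at hj
    rw [Finset.mem_Icc]; omega
  refine le_trans ?_ (Finset.sum_le_sum_of_subset_of_nonneg hsub fun _ _ _ => sq_nonneg _)
  rw [Finset.sum_pair (by omega)]
  have f1 : (k : ℝ) ≤ m * t := Int.floor_le _
  have f2 : (m : ℝ) * t < k + 1 := Int.lt_floor_add_one _
  have e1 : tent m k t = 1 - (m * t - k) := by
    unfold tent
    rw [abs_of_nonneg (by linarith), max_eq_right (by linarith)]
  have e2 : tent m (k + 1) t = m * t - k := by
    unfold tent
    rw [abs_of_nonpos (by push_cast; linarith), max_eq_right (by push_cast; linarith)]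
    push_cast; ring
  rw [e1, e2]
  nlinarith [sq_nonneg (2 * (m * t - k) - 1)]

/-- The contribution of the bump `β` to the squared `L²(P)` distance of shear maps. -/
noncomputable def bumpMass (P : Measure Square) (β : ℝ → ℝ) : ℝ≥0∞ := ∫⁻ x, wt x * ‖β (x.1 0)‖ₑ ^ 2 ∂P

/-- There are finitely many disjointly supported bumps, each of small mass, which together
have a fixed proportion of the total mass. -/
theorem exists_bumps {P : Measure Square} [IsProbabilityMeasure P] (hP : P ≪ lebesgueSquare)
    {ε : ℝ≥0∞} (hε : ε ≠ 0) :
    ∃ (s : Finset ℤ) (b : s → ℝ → ℝ),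
      (∀ k, ∃ K : NNReal, LipschitzWith K (b k)) ∧
      (∀ k t, b k t ∈ Set.Icc (0 : ℝ) 1) ∧
      (∀ t j k, b j t ≠ 0 → b k t ≠ 0 → j = k) ∧
      (∫⁻ x, wt x ∂P) / 4 ≤ ∑ k, bumpMass P (b k) ∧
      ∀ k, bumpMass P (b k) ≤ ε := by
  have : IsProbabilityMeasure (P.map (fun x : Square => x.1 0)) :=
    Measure.isProbabilityMeasure_map (measurable_coord 0).aemeasurable
  obtain ⟨δ, hδ, hsmall⟩ :=
    exists_delta_of_absolutelyContinuous (map_coord_absolutelyContinuous hP 0) hε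
  -- Each tent is supported on a strip of width `2 / m`, whose mass is below `ε` once `2 / m < δ`.
  obtain ⟨m, hm0, hm⟩ : ∃ m : ℕ, 0 < m ∧ ENNReal.ofReal (2 / m) < δ := by
    have ht : Filter.Tendsto (fun m : ℕ => ENNReal.ofReal (2 / m)) Filter.atTop (nhds 0) := by
      rw [← ENNReal.ofReal_zero]
      exact ENNReal.tendsto_ofReal (tendsto_const_div_atTop_nhds_zero_nat 2)
    exact ((Filter.eventually_gt_atTop 0).and (ht.eventually (gt_mem_nhds hδ))).exists
  have hmR : (0 : ℝ) < m := Nat.cast_pos.2 hm0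
  have hmeas : ∀ k, Measurable (fun x : Square => wt x * ‖tent m k (x.1 0)‖ₑ ^ 2) := by
    intro k
    have h1 := measurable_wt
    have h2 : Measurable (tent m k) := by unfold tent; fun_prop
    have h3 := measurable_coord 0
    fun_prop
  have hmass : ∀ k, bumpMass P (tent m k) ≤ ε := by
    intro k
    set A : Set ℝ := Set.Ioo ((k - 1) / m) ((k + 1) / m) with hA
    have hAm : MeasurableSet A := measurableSet_Ioo
    have hlt : volume A < δ := by
      rw [hA, Real.volume_Ioo]
      convert hm using 2
      field_simp; ring
    calc bumpMass P (tent m k)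
        ≤ ∫⁻ x, ((fun x : Square => x.1 0) ⁻¹' A).indicator 1 x ∂P := by
          refine lintegral_mono fun x => ?_
          by_cases hz : tent m k (x.1 0) = 0
          · simp [hz]
          · have h1 := abs_lt.1 (abs_lt_of_tent_ne_zero hz)
            have hx : x ∈ (fun x : Square => x.1 0) ⁻¹' A := by
              simp only [hA, Set.mem_preimage, Set.mem_Ioo, div_lt_iff₀ hmR, lt_div_iff₀ hmR]
              constructor <;> linarith
            rw [Set.indicator_of_mem hx]
            refine mul_le_one' (wt_le_one x) (pow_le_one₀ zero_le ?_)
            have h2 := tent_mem_Icc m k (x.1 0)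
            rw [Real.enorm_of_nonneg h2.1, ← ENNReal.ofReal_one]
            exact ENNReal.ofReal_le_ofReal h2.2
      _ = P ((fun x : Square => x.1 0) ⁻¹' A) :=
          lintegral_indicator_one (measurable_coord 0 hAm)
      _ ≤ ε := by
          rw [← Measure.map_apply (measurable_coord 0) hAm]
          exact (hsmall A hAm hlt).le
  set I := Finset.Icc (-(m : ℤ)) (m + 1)
  have htotal : (∫⁻ x, wt x ∂P) / 2 ≤ ∑ k ∈ I, bumpMass P (tent m k) := by
    simp only [bumpMass]
    rw [← lintegral_finsetSum _ fun k _ => hmeas k, ENNReal.div_eq_inv_mul,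
      ← lintegral_const_mul _ measurable_wt]
    refine lintegral_mono fun x => ?_
    rw [← Finset.mul_sum, mul_comm]
    gcongr
    have h := half_le_sum_tent_sq m (x.2 0)
    calc (2 : ℝ≥0∞)⁻¹ = ENNReal.ofReal (1 / 2) := by
          rw [one_div, ENNReal.ofReal_inv_of_pos two_pos, ENNReal.ofReal_ofNat]
      _ ≤ ENNReal.ofReal (∑ k ∈ I, tent m k (x.1 0) ^ 2) := ENNReal.ofReal_le_ofReal h
      _ = ∑ k ∈ I, ‖tent m k (x.1 0)‖ₑ ^ 2 := by
          rw [ENNReal.ofReal_sum_of_nonneg fun _ _ => sq_nonneg _]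
          refine Finset.sum_congr rfl fun k _ => ?_
          have h2 := (tent_mem_Icc m k (x.1 0)).1
          rw [Real.enorm_of_nonneg h2, ENNReal.ofReal_pow h2]
  -- One of the two parity classes carries at least half of the mass `W / 2` found in `htotal`,
  -- where `W` is the integral of `wt`.
  have hparity : ∃ r : ℤ, (∫⁻ x, wt x ∂P) / 4 ≤
      ∑ k ∈ I with k % 2 = r, bumpMass P (tent m k) := by
    by_contra! hc
    have h0 := hc 0
    have h1 := hc 1
    have hfil : (I.filter fun k => ¬ k % 2 = 0) = I.filter fun k => k % 2 = 1 := by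
      ext k
      simp only [Finset.mem_filter]
      constructor <;> rintro ⟨h, h'⟩ <;> exact ⟨h, by omega⟩
    have hs := Finset.sum_filter_add_sum_filter_not I (fun k => k % 2 = 0)
      (fun k => bumpMass P (tent m k))
    rw [hfil] at hs
    have hlt := ENNReal.add_lt_add h0 h1
    rw [hs] at hlt
    refine absurd (htotal.trans_lt hlt) (not_lt.2 (le_of_eq ?_))
    rw [← two_mul, div_eq_mul_inv, div_eq_mul_inv, mul_left_comm]
    congr 1
    rw [show (4 : ℝ≥0∞) = 2 * 2 by norm_num, ENNReal.mul_inv (by simp) (by simp), ← mul_assoc,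
      ENNReal.mul_inv_cancel (by simp) (by simp), one_mul]
  obtain ⟨r, hr⟩ := hparity
  refine ⟨I.filter fun k => k % 2 = r, fun k => tent m k, fun k => exists_lipschitzWith_tent m k,
    fun k => tent_mem_Icc m k, fun t j k hj hk => Subtype.ext (eq_of_tent_ne_zero hj hk ?_),
    hr.trans_eq (Finset.sum_coe_sort _ fun k => bumpMass P (tent m k)).symm,
    fun k => hmass k⟩
  rw [(Finset.mem_filter.1 j.2).2, (Finset.mem_filter.1 k.2).2]

/-! ### Squared distance and the risk -/

theorem enorm_sq_eq_ofReal (x : ℝ) : ‖x‖ₑ ^ 2 = ENNReal.ofReal (x ^ 2) := by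
  rw [← ofReal_norm, ← ENNReal.ofReal_pow (norm_nonneg _), Real.norm_eq_abs, sq_abs]

theorem enorm_sub_sq_le (a b g : ℝ) :
    ‖a - b‖ₑ ^ 2 ≤ 2 * ‖g - a‖ₑ ^ 2 + 2 * ‖g - b‖ₑ ^ 2 := by
  simp only [enorm_sq_eq_ofReal]
  rw [← mul_add, ← ENNReal.ofReal_add (sq_nonneg _) (sq_nonneg _),
    show (2 : ℝ≥0∞) = ENNReal.ofReal 2 by simp, ← ENNReal.ofReal_mul two_pos.le]
  exact ENNReal.ofReal_le_ofReal (by nlinarith [sq_nonneg ((g - a) + (g - b))])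

/-- The squared `L²(P)` distance of two plane-valued functions. -/
noncomputable def sqDist (P : Measure Square) (g f : Square → Plane) : ℝ≥0∞ :=
  ∑ j : Fin 2, ∫⁻ x, ‖g x j - f x j‖ₑ ^ 2 ∂P

theorem sqDist_le_inverseRisk (P : Measure Square) (c : Plane) (g f : Square → Plane) :
    sqDist P g f ≤ inverseRisk P c g f := by
  refine le_trans (le_of_eq ?_) le_self_add
  simp only [l2norm, sqDist, PiLp.sub_apply]
  rw [← ENNReal.rpow_natCast, ← ENNReal.rpow_mul]
  simp

theorem sqDist_le_two_mul_add (P : Measure Square) {f f' g : Square → Plane}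
    (hf : Measurable f) (hg : Measurable g) :
    sqDist P f f' ≤ 2 * sqDist P g f + 2 * sqDist P g f' := by
  simp only [sqDist, Finset.mul_sum]
  rw [← Finset.sum_add_distrib]
  refine Finset.sum_le_sum fun j _ => ?_
  have hm : Measurable fun x => ‖g x j - f x j‖ₑ ^ 2 := by fun_prop
  calc ∫⁻ x, ‖f x j - f' x j‖ₑ ^ 2 ∂P
      ≤ ∫⁻ x, 2 * ‖g x j - f x j‖ₑ ^ 2 + 2 * ‖g x j - f' x j‖ₑ ^ 2 ∂P :=
        lintegral_mono fun x => enorm_sub_sq_le _ _ _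
    _ = _ := by
        rw [lintegral_add_left (hm.const_mul 2), lintegral_const_mul _ hm,
          lintegral_const_mul' _ _ (by simp)]

theorem measurable_of_mem_biLipInv {f : Square → Square} (hf : f ∈ biLipInv) :
    Measurable f := by
  obtain ⟨-, L, hL, h⟩ := hf
  exact (LipschitzWith.of_dist_le_mul (K := L.toNNReal) fun x x' => by
    rw [Real.coe_toNNReal L hL.le]; exact (h x x').2).continuous.measurable

theorem measurable_toPlane {f : Square → Square} (hf : Measurable f) :
    Measurable (toPlane f) := hf.subtype_val

/-! ### The three-level family of profiles -/

/-- Three equispaced values in `[-1, 1]`. -/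
noncomputable def level (a : ZMod 3) : ℝ := (ZMod.val a : ℝ) - 1

theorem abs_level_le (a : ZMod 3) : |level a| ≤ 1 := by
  fin_cases a <;> norm_num [level, ZMod.val]

theorem one_le_abs_level_sub {a a' : ZMod 3} (h : a ≠ a') : 1 ≤ |level a - level a'| := by
  have hv : (ZMod.val a : ℤ) - ZMod.val a' ≠ 0 := by
    intro h0
    exact h (ZMod.val_injective 3 (by omega))
  have := Int.one_le_abs hv
  have h2 : level a - level a' = (((ZMod.val a : ℤ) - ZMod.val a' : ℤ) : ℝ) := by
    unfold level; push_cast; ring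
  rw [h2]
  exact_mod_cast this

section Prior

variable {ι : Type} [Fintype ι] {b : ι → ℝ → ℝ}

/-- The profile with level `ω k` on the `k`-th bump. -/
noncomputable def profile (b : ι → ℝ → ℝ) (ω : ι → ZMod 3) (t : ℝ) : ℝ :=
  ∑ k, level (ω k) * b k t

theorem sum_mul_eq_of_ne_zero (hdisj : ∀ t j k, b j t ≠ 0 → b k t ≠ 0 → j = k)
    {t : ℝ} {k : ι} (hk : b k t ≠ 0) (c : ι → ℝ) : ∑ j, c j * b j t = c k * b k t := by
  refine Finset.sum_eq_single k (fun j _ hj => ?_) (by simp)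
  have : b j t = 0 := by
    by_contra h
    exact hj (hdisj t j k h hk)
  simp [this]

theorem abs_profile_le (hb : ∀ k t, b k t ∈ Set.Icc (0 : ℝ) 1)
    (hdisj : ∀ t j k, b j t ≠ 0 → b k t ≠ 0 → j = k) (ω : ι → ZMod 3) (t : ℝ) :
    |profile b ω t| ≤ 1 := by
  by_cases h : ∃ k, b k t ≠ 0
  · obtain ⟨k, hk⟩ := h
    rw [profile, sum_mul_eq_of_ne_zero hdisj hk fun j => level (ω j), abs_mul]
    refine mul_le_one₀ (abs_level_le _) (abs_nonneg _) ?_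
    rw [abs_of_nonneg (hb k t).1]
    exact (hb k t).2
  · push Not at h
    simp [profile, h]

theorem exists_lipschitzWith_profile (hlip : ∀ k, ∃ K : NNReal, LipschitzWith K (b k))
    (ω : ι → ZMod 3) : ∃ K : NNReal, LipschitzWith K (profile b ω) := by
  choose K hK using hlip
  refine ⟨∑ k, ‖level (ω k)‖₊ * K k, LipschitzWith.of_dist_le_mul fun s t => ?_⟩
  unfold profile
  refine (dist_sum_sum_le _ _ _).trans ?_
  rw [NNReal.coe_sum, Finset.sum_mul]
  refine Finset.sum_le_sum fun k _ => ?_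
  have h := (hK k).dist_le_mul s t
  rw [Real.dist_eq] at h
  rw [Real.dist_eq, ← mul_sub, abs_mul, NNReal.coe_mul, coe_nnnorm, Real.norm_eq_abs, mul_assoc]
  gcongr

/-- Two maps of the family differ by at least the mass of the bumps on which their levels
differ. -/
theorem sum_bumpMass_le_sqDist (P : Measure Square) (hmeas : ∀ k, Measurable (b k))
    (hdisj : ∀ t j k, b j t ≠ 0 → b k t ≠ 0 → j = k) {ω ω' : ι → ZMod 3}
    (hω : ∀ t, |profile b ω t| ≤ 1) (hω' : ∀ t, |profile b ω' t| ≤ 1)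
    {A : Finset ι} (hA : ∀ k ∈ A, ω k ≠ ω' k) :
    ∑ k ∈ A, bumpMass P (b k) ≤
      sqDist P (toPlane (shear (profile b ω) hω)) (toPlane (shear (profile b ω') hω')) := by
  rw [sqDist, Fin.sum_univ_two]
  -- Shears fix the first coordinate, so only the second contributes.
  refine le_trans ?_ le_add_self
  simp only [bumpMass]
  rw [← lintegral_finsetSum]
  · refine lintegral_mono fun x => ?_
    simp only [toPlane, shear_one]
    have hd : x.1 1 + profile b ω (x.1 0) * ((1 - x.1 1 ^ 2) / 4)
        - (x.1 1 + profile b ω' (x.1 0) * ((1 - x.1 1 ^ 2) / 4))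
        = (1 - x.1 1 ^ 2) / 4 * ∑ k, (level (ω k) - level (ω' k)) * b k (x.1 0) := by
      simp only [profile, sub_mul, Finset.sum_sub_distrib]
      ring
    rw [hd]
    by_cases h : ∃ k ∈ A, b k (x.1 0) ≠ 0
    · obtain ⟨k, hkA, hk⟩ := h
      rw [sum_mul_eq_of_ne_zero hdisj hk, Finset.sum_eq_single_of_mem k hkA, enorm_mul,
        enorm_mul, mul_pow, mul_pow]
      · unfold wt
        gcongr
        have h1 := one_le_abs_level_sub (hA k hkA)
        refine le_mul_of_one_le_left zero_le ?_
        rw [enorm_sq_eq_ofReal, ENNReal.one_le_ofReal, ← sq_abs]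
        exact one_le_pow₀ h1
      · intro j _ hj
        have : b j (x.1 0) = 0 := by
          by_contra h
          exact hj (hdisj _ j k h hk)
        simp [this]
    · push Not at h
      rw [Finset.sum_eq_zero fun k hk => by simp [h k hk]]
      exact zero_le
  · intro k _
    have h1 := measurable_wt
    have h2 := hmeas k
    have h3 := measurable_coord 0
    fun_prop

end Prior

/-! ### Counting arguments -/

/-- Bumps which do not vanish at one of `n` given points have total mass at most `n ε`. -/
theorem sum_bumpMass_touched_le {ι : Type} {b : ι → ℝ → ℝ} (P : Measure Square) {ε : ℝ≥0∞}
    (hdisj : ∀ t j k, b j t ≠ 0 → b k t ≠ 0 → j = k)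
    (hε : ∀ k, bumpMass P (b k) ≤ ε) {n : ℕ} (t : Fin n → ℝ) {A : Finset ι}
    (hA : ∀ k ∈ A, ∃ i, b k (t i) ≠ 0) : ∑ k ∈ A, bumpMass P (b k) ≤ n * ε := by
  have hcard : A.card ≤ n := by
    obtain rfl | ⟨k₀, hk₀⟩ := A.eq_empty_or_nonempty
    · simp
    have : Nonempty (Fin n) := ⟨(hA k₀ hk₀).choose⟩
    choose! i hi using hA
    -- By disjointness a design point meets at most one bump, so choosing a point for each touched
    -- bump is injective.
    calc A.card ≤ (Finset.univ : Finset (Fin n)).card :=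
          Finset.card_le_card_of_injOn i (fun _ _ => Finset.mem_univ _) fun j hj k hk hjk =>
            hdisj (t (i j)) j k (hi j hj) (by rw [hjk]; exact hi k hk)
      _ = n := by simp
  calc ∑ k ∈ A, bumpMass P (b k) ≤ A.card • ε :=
        Finset.sum_le_card_nsmul _ _ _ fun k _ => hε k
    _ ≤ n * ε := by
        rw [nsmul_eq_mul]
        gcongr

/-- If a property holds at most once along each orbit of three permutations, then it holds for
at most a third of the elements. -/
theorem three_mul_card_filter_le {Ω : Type} [Fintype Ω] (T : ZMod 3 → Equiv.Perm Ω) (p : Ω → Prop)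
    [DecidablePred p] (h : ∀ ω a a', p (T a ω) → p (T a' ω) → a = a') :
    3 * (Finset.univ.filter p).card ≤ Fintype.card Ω := by
  have h1 : ∀ a : ZMod 3, (Finset.univ.filter p).card = ∑ ω, if p (T a ω) then 1 else 0 := by
    intro a
    rw [Finset.card_filter, ← Equiv.sum_comp (T a)]
  calc 3 * (Finset.univ.filter p).card = ∑ _a : ZMod 3, (Finset.univ.filter p).card := by
        simp [ZMod.card]
    _ = ∑ ω, ∑ a : ZMod 3, if p (T a ω) then 1 else 0 := by
        rw [Finset.sum_comm]
        exact Finset.sum_congr rfl fun a _ => h1 a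
    _ ≤ ∑ _ω : Ω, 1 := by
        refine Finset.sum_le_sum fun ω _ => ?_
        rw [← Finset.card_filter, Finset.card_le_one]
        intro a ha a' ha'
        exact h ω a a' (Finset.mem_filter.1 ha).2 (Finset.mem_filter.1 ha').2
    _ = Fintype.card Ω := by simp

/-! ### Sampling model -/

/-- The sample as a function of the design points and the noise. -/
def observe (f : Square → Square) {n : ℕ} (z : Fin n → Square × Plane) :
    Fin n → Square × Plane :=
  fun i => ((z i).1, toPlane f (z i).1 + (z i).2)

/-- The law of the design points and the noise. -/
noncomputable def designLaw (P : Measure Square) (σ : ℝ) (n : ℕ) :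
    Measure (Fin n → Square × Plane) :=
  Measure.pi fun _ =>
    P.prod (multivariateGaussian (0 : Plane) (σ ^ 2 • (1 : Matrix (Fin 2) (Fin 2) ℝ)))

instance (P : Measure Square) [IsProbabilityMeasure P] (σ : ℝ) (n : ℕ) :
    IsProbabilityMeasure (designLaw P σ n) := by
  unfold designLaw
  infer_instance

theorem measurable_observe {f : Square → Square} (hf : Measurable f) (n : ℕ) :
    Measurable (observe f (n := n)) := by
  have := measurable_toPlane hf
  unfold observe
  fun_prop

/-- This couples the samples for all `f` on one space of design points and noise, so that the maps
can be compared pointwise. -/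
theorem dataLaw_eq_map (P : Measure Square) [IsProbabilityMeasure P] (σ : ℝ)
    {f : Square → Square} (hf : Measurable f) (n : ℕ) :
    dataLaw P σ f n = (designLaw P σ n).map (observe f) := by
  have hm : Measurable fun p : Square × Plane => (p.1, toPlane f p.1 + p.2) := by
    have := measurable_toPlane hf
    fun_prop
  have : IsProbabilityMeasure (obsLaw P σ f) := Measure.isProbabilityMeasure_map hm.aemeasurable
  unfold dataLaw designLaw observe obsLaw
  have hfin : ∀ _ : Fin n, SigmaFinite ((P.prod (multivariateGaussian (0 : Plane)
      (σ ^ 2 • (1 : Matrix (Fin 2) (Fin 2) ℝ)))).map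
        fun p : Square × Plane => (p.1, toPlane f p.1 + p.2)) := by
    intro _
    change SigmaFinite (obsLaw P σ f)
    infer_instance
  exact (Measure.pi_map_pi (hμ := hfin) fun _ => hm.aemeasurable).symm

theorem measurable_sqDist (P : Measure Square) [IsProbabilityMeasure P] {n : ℕ}
    (F : Estimator n) {f : Square → Plane} (hf : Measurable f) :
    Measurable fun D => sqDist P (F.1 D) f := by
  unfold sqDist
  refine Finset.measurable_sum _ fun j _ => ?_
  have h : Measurable fun q : (Fin n → Square × Plane) × Square => F.1 q.1 q.2 := F.2
  have h2 : Measurable fun q : (Fin n → Square × Plane) × Square =>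
      ‖F.1 q.1 q.2 j - f q.2 j‖ₑ ^ 2 := by
    have h3 : Measurable fun q : (Fin n → Square × Plane) × Square => F.1 q.1 q.2 j := by
      fun_prop
    have h4 : Measurable fun q : (Fin n → Square × Plane) × Square => f q.2 j := by
      fun_prop
    exact (h3.sub h4).enorm.pow_const 2
  exact h2.lintegral_prod_right'

/-! ### Averaging over the family -/

section Bayes

variable {ι : Type} [Fintype ι] {b : ι → ℝ → ℝ}

/-- For fixed design points and noise, at most a third of the regression functions of the family
are estimated with squared error below `s`. -/
theorem three_mul_card_sqDist_lt_le (P : Measure Square) [IsProbabilityMeasure P]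
    (hmeas : ∀ k, Measurable (b k))
    (hdisj : ∀ t j k, b j t ≠ 0 → b k t ≠ 0 → j = k)
    (hθ : ∀ ω t, |profile b ω t| ≤ 1)
    (hshear : ∀ ω, Measurable (shear (profile b ω) (hθ ω)))
    {s ε : ℝ≥0∞} (hs : s ≠ ∞) {n : ℕ} (hnε : n * ε ≤ 4 * s)
    (hsum : 8 * s ≤ ∑ k, bumpMass P (b k)) (hε : ∀ k, bumpMass P (b k) ≤ ε)
    (F : Estimator n) (z : Fin n → Square × Plane)
    [DecidableEq ι] [DecidablePred fun ω : ι → ZMod 3 =>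
      sqDist P (F.1 (observe (shear (profile b ω) (hθ ω)) z))
        (toPlane (shear (profile b ω) (hθ ω))) < s] :
    3 * (Finset.univ.filter fun ω : ι → ZMod 3 =>
      sqDist P (F.1 (observe (shear (profile b ω) (hθ ω)) z))
        (toPlane (shear (profile b ω) (hθ ω))) < s).card ≤ Fintype.card (ι → ZMod 3) := by
  classical
  set t : Fin n → ℝ := fun i => (z i).1.1 0 with ht
  set A : Finset ι := Finset.univ.filter fun k => ∃ i, b k (t i) ≠ 0 with hA
  have hA1 : ∀ k ∈ A, ∃ i, b k (t i) ≠ 0 := fun k hk => (Finset.mem_filter.1 hk).2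
  have hA2 : ∀ k ∉ A, ∀ i, b k (t i) = 0 := by
    intro k hk i
    by_contra h
    exact hk (Finset.mem_filter.2 ⟨Finset.mem_univ _, i, h⟩)
  -- Touched bumps use up at most `n * ε ≤ 4 * s` of a total of at least `8 * s`.
  have hunt : 4 * s ≤ ∑ k ∈ Aᶜ, bumpMass P (b k) := by
    have h1 := (sum_bumpMass_touched_le P hdisj hε t hA1).trans hnε
    rw [← Finset.sum_add_sum_compl A] at hsum
    have h2 : 4 * s + 4 * s ≤ 4 * s + ∑ k ∈ Aᶜ, bumpMass P (b k) := by
      calc 4 * s + 4 * s = 8 * s := by ring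
        _ ≤ _ := hsum
        _ ≤ _ := by gcongr
    exact (ENNReal.add_le_add_iff_left (ENNReal.mul_ne_top (by simp) hs)).1 h2
  set T : ZMod 3 → Equiv.Perm (ι → ZMod 3) := fun a =>
    Equiv.addRight fun k => if k ∈ A then 0 else a with hT
  have hTA : ∀ a ω k, k ∈ A → T a ω k = ω k := by
    intro a ω k hk
    simp [hT, hk]
  have hTAc : ∀ a ω k, k ∉ A → T a ω k = ω k + a := by
    intro a ω k hk
    simp [hT, hk]
  have hobs : ∀ a ω, observe (shear (profile b (T a ω)) (hθ _)) z
      = observe (shear (profile b ω) (hθ ω)) z := by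
    intro a ω
    have hp : ∀ i, profile b (T a ω) (t i) = profile b ω (t i) := by
      intro i
      refine Finset.sum_congr rfl fun k _ => ?_
      by_cases hk : k ∈ A
      · rw [hTA a ω k hk]
      · simp [hA2 k hk i]
    funext i
    have hsh : shear (profile b (T a ω)) (hθ _) (z i).1 = shear (profile b ω) (hθ ω) (z i).1 := by
      unfold shear
      simp only [show ((z i).1 : Plane) 0 = t i from rfl, hp i]
    simp only [observe, toPlane, hsh]
  refine three_mul_card_filter_le T _ fun ω a a' ha ha' => ?_
  by_contra hne
  rw [hobs] at ha ha'
  set D := observe (shear (profile b ω) (hθ ω)) z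
  have hg : Measurable (F.1 D) := F.2.comp (measurable_const.prodMk measurable_id)
  have hlow := sum_bumpMass_le_sqDist P hmeas hdisj (hθ (T a ω)) (hθ (T a' ω)) (A := Aᶜ)
    fun k hk => by
      have hk' := Finset.mem_compl.1 hk
      rw [hTAc a ω k hk', hTAc a' ω k hk']
      exact fun h => hne (add_left_cancel h)
  have hup := sqDist_le_two_mul_add P (f' := toPlane (shear (profile b (T a' ω)) (hθ _)))
    (measurable_toPlane (hshear (T a ω))) hg
  have hlt := ENNReal.add_lt_add ha ha'
  have hlt2 : 2 * (sqDist P (F.1 D) (toPlane (shear (profile b (T a ω)) (hθ _)))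
      + sqDist P (F.1 D) (toPlane (shear (profile b (T a' ω)) (hθ _)))) < 2 * (s + s) :=
    (ENNReal.mul_lt_mul_iff_right (by simp) (by simp)).2 hlt
  -- Two estimates within `s` would force the separation to be strictly below `2 * (s + s) = 4 * s`.
  refine absurd (((hunt.trans hlow).trans hup).trans_lt ((mul_add _ _ _).symm.trans_lt hlt2)) ?_
  rw [← two_mul, ← mul_assoc]
  norm_num

/-- For every estimator some regression function of the family is missed by `s` in squared error
with probability at least two thirds. -/
theorem exists_dataLaw_sqDist_lt_le (P : Measure Square) [IsProbabilityMeasure P] (σ : ℝ)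
    (hmeas : ∀ k, Measurable (b k))
    (hdisj : ∀ t j k, b j t ≠ 0 → b k t ≠ 0 → j = k)
    (hθ : ∀ ω t, |profile b ω t| ≤ 1)
    (hshear : ∀ ω, Measurable (shear (profile b ω) (hθ ω)))
    {s ε : ℝ≥0∞} (hs : s ≠ ∞) {n : ℕ} (hnε : n * ε ≤ 4 * s)
    (hsum : 8 * s ≤ ∑ k, bumpMass P (b k)) (hε : ∀ k, bumpMass P (b k) ≤ ε)
    (F : Estimator n) :
    ∃ ω, dataLaw P σ (shear (profile b ω) (hθ ω)) n
      {D | sqDist P (F.1 D) (toPlane (shear (profile b ω) (hθ ω))) < s} ≤ 1 / 3 := by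
  classical
  set f : (ι → ZMod 3) → Square → Square := fun ω => shear (profile b ω) (hθ ω) with hf
  set B : (ι → ZMod 3) → Set (Fin n → Square × Plane) := fun ω =>
    {D | sqDist P (F.1 D) (toPlane (f ω)) < s} with hB
  have hBm : ∀ ω, MeasurableSet (B ω) := fun ω =>
    measurableSet_lt (measurable_sqDist P F (measurable_toPlane (hshear ω))) measurable_const
  have hom : ∀ ω, MeasurableSet (observe (f ω) ⁻¹' B ω) := fun ω =>
    measurable_observe (hshear ω) n (hBm ω)
  have hlaw : ∀ ω, dataLaw P σ (f ω) n (B ω)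
      = ∫⁻ z, (observe (f ω) ⁻¹' B ω).indicator 1 z ∂designLaw P σ n := by
    intro ω
    rw [dataLaw_eq_map P σ (hshear ω), Measure.map_apply (measurable_observe (hshear ω) n) (hBm ω),
      lintegral_indicator_one (hom ω)]
  have hav : ∑ ω, dataLaw P σ (f ω) n (B ω) ≤ ∑ _ω : ι → ZMod 3, (1 / 3 : ℝ≥0∞) := by
    simp only [hlaw]
    rw [← lintegral_finsetSum _ fun ω _ => measurable_one.indicator (hom ω)]
    calc _ ≤ ∫⁻ _z, ∑ _ω : ι → ZMod 3, (1 / 3 : ℝ≥0∞) ∂designLaw P σ n := by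
          refine lintegral_mono fun z => ?_
          have h3 := three_mul_card_sqDist_lt_le P hmeas hdisj hθ hshear hs hnε hsum hε F z
          simp only [Set.indicator_apply, Pi.one_apply, Finset.sum_const, Finset.card_univ,
            nsmul_eq_mul]
          rw [Finset.sum_boole, mul_one_div, ENNReal.le_div_iff_mul_le (by simp) (by simp),
            mul_comm]
          have h3' : 3 * (Finset.univ.filter fun ω => z ∈ observe (f ω) ⁻¹' B ω).card
              ≤ Fintype.card (ι → ZMod 3) := by
            convert h3
            exact Iff.rfl
          exact_mod_cast h3'
      _ = _ := by simp
  by_contra! hc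
  exact absurd hav
    (not_le.2 (ENNReal.sum_lt_sum_of_nonempty Finset.univ_nonempty fun ω _ => hc ω))

end Bayes

end InvReg

/-! ### The lower bound -/

theorem mainTheorem2
    (σ : ℝ) (hσ : 0 < σ)
    (PX : Measure InvReg.Square) [IsProbabilityMeasure PX]
    (hac : PX ≪ InvReg.lebesgueSquare) (hsupp : PX.support = Set.univ) :
    ∃ C : ℝ, 0 < C ∧
      ∀ c : InvReg.Plane, c ∉ InvReg.square →
        ∀ n : ℕ, 1 ≤ n →
          (1 / 2 : ℝ≥0∞) <
            ⨅ fhat : InvReg.Estimator n, ⨆ f ∈ InvReg.biLipInv,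
              InvReg.dataLaw PX σ f n
                {D | ENNReal.ofReal (C * (n : ℝ) ^ (-2 / (2 + 2) : ℝ)) ≤
                  InvReg.inverseRisk PX c (fhat.1 D) (InvReg.toPlane f)} := by
  open InvReg in
  set W := ∫⁻ x, wt x ∂PX with hW
  have hW0 : W ≠ 0 := (lintegral_wt_pos hac).ne'
  have hWt : W ≠ ∞ := by
    refine ne_top_of_le_ne_top ENNReal.one_ne_top ((lintegral_mono wt_le_one).trans ?_)
    simp
  -- Chosen so that `8 * s = W / 4`, the total mass guaranteed by `exists_bumps`.
  set s := W / 32 with hs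
  have hs0 : s ≠ 0 := ENNReal.div_ne_zero.2 ⟨hW0, by simp⟩
  have hst : s ≠ ∞ := ENNReal.div_ne_top hWt (by simp)
  have h8s : 8 * s = W / 4 := by
    rw [hs, ← mul_div_assoc, show (32 : ℝ≥0∞) = 8 * 4 by norm_num,
      ENNReal.mul_div_mul_left _ _ (by simp) (by simp)]
  refine ⟨s.toReal, ENNReal.toReal_pos hs0 hst, fun c _ n hn => ?_⟩
  have hn0 : (n : ℝ≥0∞) ≠ 0 := by
    rw [Nat.cast_ne_zero]; omega
  have hCs : ENNReal.ofReal (s.toReal * (n : ℝ) ^ (-2 / (2 + 2) : ℝ)) ≤ s := by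
    rw [← ENNReal.ofReal_toReal hst]
    refine ENNReal.ofReal_le_ofReal ?_
    rw [ENNReal.ofReal_toReal hst]
    refine mul_le_of_le_one_right ENNReal.toReal_nonneg ?_
    exact Real.rpow_le_one_of_one_le_of_nonpos (by exact_mod_cast hn) (by norm_num)
  -- The choice `ε = 4 * s / n` caps the mass of `n` touched bumps at `4 * s`, half of `8 * s`.
  obtain ⟨S, b, hlip, hb, hdisj, hsum, hsmall⟩ := exists_bumps hac (ε := 4 * s / n)
    (ENNReal.div_ne_zero.2 ⟨mul_ne_zero (by simp) hs0, by simp⟩)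
  have hmeas : ∀ k, Measurable (b k) := fun k => (hlip k).choose_spec.continuous.measurable
  have hθ := abs_profile_le hb hdisj
  have hmem : ∀ ω, shear (profile b ω) (hθ ω) ∈ biLipInv := fun ω =>
    shear_mem_biLipInv _ _ (exists_lipschitzWith_profile hlip ω).choose_spec
  have hshear := fun ω => measurable_of_mem_biLipInv (hmem ω)
  have h12 : (1 / 2 : ℝ≥0∞) < 1 - 1 / 3 := by
    rw [← ENNReal.toReal_lt_toReal (by simp) (by simp),
      ENNReal.toReal_sub_of_le (by simp) (by simp)]
    norm_num
  refine h12.trans_le (le_iInf fun F => ?_)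
  obtain ⟨ω, hω⟩ := exists_dataLaw_sqDist_lt_le PX σ hmeas hdisj hθ hshear hst
    (ENNReal.mul_div_cancel hn0 (ENNReal.natCast_ne_top n)).le (h8s.trans_le hsum) hsmall F
  refine le_iSup₂_of_le _ (hmem ω) ?_
  set f := shear (profile b ω) (hθ ω)
  have hprob : IsProbabilityMeasure (dataLaw PX σ f n) := by
    rw [dataLaw_eq_map PX σ (hshear ω)]
    exact Measure.isProbabilityMeasure_map (measurable_observe (hshear ω) n).aemeasurable
  have hBm : MeasurableSet {D | sqDist PX (F.1 D) (toPlane f) < s} :=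
    measurableSet_lt (measurable_sqDist PX F (measurable_toPlane (hshear ω))) measurable_const
  calc 1 - 1 / 3 ≤ 1 - dataLaw PX σ f n {D | sqDist PX (F.1 D) (toPlane f) < s} := by gcongr
    _ = dataLaw PX σ f n {D | sqDist PX (F.1 D) (toPlane f) < s}ᶜ :=
      (prob_compl_eq_one_sub hBm).symm
    _ ≤ _ := measure_mono fun D hD =>
      (hCs.trans (not_lt.1 hD)).trans (sqDist_le_inverseRisk PX c (F.1 D) (toPlane f))
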